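/- Let $N\in\{2,3\}$. All solutions are classical (twice differentiable) and real valued. (i) The only solution $w:\mathbb R\to\mathbb R$ of the radial entire problem with $k=2$, $\lambda=0$, $$-w''+(N-2)w'+(N-1)w=\tfrac{N-1}{2}\,e^{-t}w^2 \ \text{ on } \mathbb R,\qquad \lim_{t\to-\infty}w(t)=\lim_{t\to+\infty}w(t)=0,$$ is $w\equiv 0$. (ii) Equivalently (with $w=e^{t}z$), the only solution $z:\mathbb R\to\mathbb R$ of $$-z''+(N-4)z'+(2N-4)z=\tfrac{N-1}{2}\,z^2 \ \text{ on } \mathbb R, \qquad(*)$$ $$\lim_{t\to-\infty}e^{t}z(t)=0=\lim_{t\to+\infty}e^{t}z(t),$$ is $z\equiv 0$. (iii) Let $z$ be a solution of the differential equation in $(*)$ on a maximal open interval $I$ of existence that is unbounded above, with $z\not\equiv0$ on $I$, and suppose that its orbit lies on the stable manifold of the origin, i.e. $(z(t),z'(t))\to(0,0)$ as $t\to+\infty$. Then $z$ is unbounded backward in time: for every $t_0\in I$, $z$ is unbounded on $I\cap(-\infty,t_0]$. (iv) A solution $z$ of the differential equation in $(*)$, on an open interval $I$ unbounded above, with $z\not\equiv0$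 on $I$ and $z(t)\to0$ as $t\to+\infty$, is not defined on the whole real line: $I\neq\mathbb R$. -/

import Mathlib

open Set Filter Topology

namespace RadialHessian

/-- `w` is a classical solution on the whole line of the radial entire problem with `k = 2`, `λ = 0`,
`-w'' + (N-2) w' + (N-1) w = ((N-1)/2) e^{-t} w²`, `w(-∞) = w(+∞) = 0`. -/
def IsEntireSolution (N : ℕ) (w : ℝ → ℝ) : Prop :=
  (∀ t : ℝ, DifferentiableAt ℝ w t ∧ DifferentiableAt ℝ (deriv w) t ∧
    -(deriv (deriv w) t) + ((N : ℝ) - 2) * deriv w t + ((N : ℝ) - 1) * w t =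
      ((N : ℝ) - 1) / 2 * Real.exp (-t) * w t ^ 2) ∧
  Tendsto w atBot (𝓝 0) ∧ Tendsto w atTop (𝓝 0)

/-- `z` is a classical solution on the open set `I` of the autonomous equation
`-z'' + (N-4) z' + (2N-4) z = ((N-1)/2) z²`. Only used for open `I`. -/
def SolvesOn (N : ℕ) (z : ℝ → ℝ) (I : Set ℝ) : Prop :=
  ∀ t ∈ I, DifferentiableAt ℝ z t ∧ DifferentiableAt ℝ (deriv z) t ∧
    -(deriv (deriv z) t) + ((N : ℝ) - 4) * deriv z t + (2 * (N : ℝ) - 4) * z t =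
      ((N : ℝ) - 1) / 2 * z t ^ 2

/-- The boundary conditions `e^t z(t) → 0` as `t → -∞` and as `t → +∞`. -/
def EntireBC (z : ℝ → ℝ) : Prop :=
  Tendsto (fun t => Real.exp t * z t) atBot (𝓝 0) ∧
  Tendsto (fun t => Real.exp t * z t) atTop (𝓝 0)

/-- `z` is a solution on the open interval `I` and has no extension, as a solution,
to a strictly larger open interval. -/
def IsMaximalSolution (N : ℕ) (z : ℝ → ℝ) (I : Set ℝ) : Prop :=
  IsOpen I ∧ I.OrdConnected ∧ SolvesOn N z I ∧
  ∀ (J : Set ℝ) (y : ℝ → ℝ), IsOpen J → J.OrdConnected → I ⊆ J → SolvesOn N y J →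
    EqOn y z I → J = I

/-- The orbit `(z, z')` of a solution defined near `+∞` lies on the stable manifold of the origin:
it converges to `(0, 0)` as `t → +∞`. -/
def OnStableManifold (z : ℝ → ℝ) : Prop :=
  Tendsto (fun t => (z t, deriv z t)) atTop (𝓝 ((0 : ℝ), (0 : ℝ)))

end RadialHessian

namespace RadialHessian

/-! Energy argument with time reversed. Along z, the energy E = z'²/2 + c z³/3 - b z²/2, with b =
2N-4 ≥ 0 and c = (N-1)/2 > 0, satisfies E' = (N-4) z'² ≤ 0. If z → 0 at +∞, the potential part of E
vanishes there, so E ≥ 0. If E ≡ 0, then z' ≡ 0 and z ≡ 0; otherwise E ≥ δ > 0 at all earlier times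
(`exists_energy_lower_bound`). With y(s) = z(-s) and a = 4-N, this orbit solves y'' = a y' + b y - c
y². A positive energy makes every turning point a maximum, so y is eventually monotone; it cannot
rise forever, and once it falls it blows up to -∞ in finite time (`not_global_of_energy_pos`). Hence
no nontrivial such z is global. A bounded z would extend past a finite left endpoint
(`exists_extension`), which maximality forbids. -/

/-- A function whose derivative is at most `-m` lies below the corresponding affine function. -/
lemma le_affine_of_deriv_le {f f' : ℝ → ℝ} {s₀ m : ℝ}
    (hf : ∀ s ≥ s₀, HasDerivAt f (f' s) s) (hm : ∀ s ≥ s₀, f' s ≤ -m) :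
    ∀ s ≥ s₀, f s ≤ f s₀ - m * (s - s₀) := by
  intro s hs
  have h := (convex_Ici s₀).image_sub_le_mul_sub_of_deriv_le (f := f) (C := -m)
    (fun x hx => (hf x hx).continuousAt.continuousWithinAt)
    (fun x hx => (hf x (interior_subset hx)).differentiableAt.differentiableWithinAt)
    (fun x hx => by
      rw [(hf x (interior_subset hx)).deriv]; exact hm x (interior_subset hx))
    s₀ self_mem_Ici s hs hs
  linarith

/-- A function whose derivative is bounded above by a negative constant is eventually
below any given bound. -/
lemma exists_forall_le_of_deriv_le {f f' : ℝ → ℝ} {s₀ m : ℝ} (hm0 : 0 < m)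
    (hf : ∀ s ≥ s₀, HasDerivAt f (f' s) s) (hm : ∀ s ≥ s₀, f' s ≤ -m) (K : ℝ) :
    ∃ s₁ ≥ s₀, ∀ s ≥ s₁, f s ≤ K := by
  have h := le_affine_of_deriv_le hf hm
  refine ⟨s₀ + |f s₀ - K| / m, by have := abs_nonneg (f s₀ - K); simp; positivity, ?_⟩
  intro s hs
  have h0 : 0 ≤ |f s₀ - K| / m := by positivity
  have h1 := h s (by linarith)
  have h2 : |f s₀ - K| ≤ m * (s - s₀) := by
    have : |f s₀ - K| / m ≤ s - s₀ := by linarith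
    rw [div_le_iff₀ hm0] at this
    linarith
  linarith [le_abs_self (f s₀ - K)]

/-- Finite-time blow-up: a global function cannot satisfy `y < 0`, `y' ≤ 0` and
`k² |y|³ ≤ y'²` on a half-line. -/
lemma not_global_of_cube_le_sq {y v : ℝ → ℝ} {s₀ k : ℝ} (hk : 0 < k)
    (hy : ∀ s ≥ s₀, HasDerivAt y (v s) s) (hneg : ∀ s ≥ s₀, y s < 0)
    (hv : ∀ s ≥ s₀, v s ≤ 0) (hvy : ∀ s ≥ s₀, k ^ 2 * (-y s) ^ 3 ≤ v s ^ 2) : False := by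
  have hd : ∀ s ≥ s₀, HasDerivAt (fun s => (√(-y s))⁻¹)
      (-(-v s / (2 * √(-y s))) / √(-y s) ^ 2) s := fun s hs =>
    ((hy s hs).neg.sqrt (neg_pos.2 (hneg s hs)).ne').inv
      (Real.sqrt_pos.2 (neg_pos.2 (hneg s hs))).ne'
  -- `(-y)^(-1/2)` has derivative `v / (2 (-y)^(3/2)) ≤ -k/2`, so this positive quantity would reach
  -- zero in finite time.
  obtain ⟨s₁, hs₁, h⟩ := exists_forall_le_of_deriv_le (half_pos hk) hd (fun s hs => by
    have hp : 0 < √(-y s) := Real.sqrt_pos.2 (by have := hneg s hs; linarith)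
    have hsq : √(-y s) ^ 2 = -y s := Real.sq_sqrt (by have := hneg s hs; linarith)
    have h1 : k * √(-y s) ^ 3 ≤ -v s := by
      refine le_of_sq_le_sq ?_ (by have := hv s hs; linarith)
      have := hvy s hs
      rw [← hsq] at this
      nlinarith
    rw [div_le_iff₀ (by positivity), neg_div, neg_neg, div_le_iff₀ (by positivity)]
    nlinarith) 0
  have := h s₁ le_rfl
  have hp : 0 < √(-y s₁) := Real.sqrt_pos.2 (by have := hneg s₁ hs₁; linarith)
  have := inv_pos.2 hp
  linarith

/-! ### Blow-up of positive-energy orbits in reversed time -/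

section

variable {a b c δ s₁ : ℝ} {y v : ℝ → ℝ}

/-- A solution of positive energy cannot be nondecreasing for all large times. -/
lemma not_forall_pos_of_energy_pos (ha : 0 < a) (hb : 0 ≤ b) (hc : 0 < c) (hδ : 0 < δ)
    (hy : ∀ s ≥ s₁, HasDerivAt y (v s) s)
    (hv : ∀ s ≥ s₁, HasDerivAt v (a * v s + b * y s - c * y s ^ 2) s)
    (hE : ∀ s ≥ s₁, δ ≤ v s ^ 2 / 2 + y s ^ 2 * (2 * c * y s - 3 * b) / 6)
    (hpos : ∀ s ≥ s₁, 0 < v s) : False := by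
  -- While `2cy ≤ 3b` the potential is nonpositive, so `v ≥ √δ` and `y` must leave this range.
  obtain ⟨s₃, hs₃, hy₃⟩ : ∃ s ≥ s₁, 3 * b < 2 * c * y s := by
    by_contra! hcon
    have hvl : ∀ s ≥ s₁, √δ ≤ v s := fun s hs => by
      refine Real.sqrt_le_iff.2 ⟨(hpos s hs).le, ?_⟩
      nlinarith [hE s hs, hcon s hs, mul_nonneg (sq_nonneg (y s)) (sub_nonneg.2 (hcon s hs))]
    obtain ⟨s, hs, h⟩ := exists_forall_le_of_deriv_le (Real.sqrt_pos.2 hδ)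
      (fun s hs => (hy s hs).neg) (fun s hs => neg_le_neg (hvl s hs)) (-(3 * b / (2 * c)) - 1)
    have h1 := h s le_rfl
    have h2 := hcon s hs
    have h3 : y s ≤ 3 * b / (2 * c) := by rw [le_div_iff₀ (by positivity)]; linarith
    simp at h1
    linarith
  have hmono : ∀ s ≥ s₃, y s₃ ≤ y s := fun s hs => by
    have := le_affine_of_deriv_le (f := fun s => -y s) (m := 0) (s₀ := s₃)
      (fun s hs => (hy s (hs₃.trans hs)).neg)
      (fun s hs => by linarith [hpos s (hs₃.trans hs)]) s hs
    linarith
  have hy₃pos : 0 < y s₃ := by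
    by_contra! h
    nlinarith
  -- Since `(v - a y)' = y (b - c y)` stays below a negative constant, eventually `v - a y ≤ -aK`;
  -- as `v > 0`, this forces `y ≥ K`. Then `v' = a (v - a y) + y (a² + b - c y) ≤ -1`, by the choice
  -- of `K`; its final `+ 1` ensures `K ≥ 1`.
  set K := (a ^ 2 + b + 1) / c + 1 with hK
  obtain ⟨s₄, hs₄, hq⟩ := exists_forall_le_of_deriv_le (f := fun s => v s - a * y s)
    (s₀ := s₃) (m := y s₃ * (c * y s₃ - b)) (mul_pos hy₃pos (by linarith))
    (fun s hs => (hv s (hs₃.trans hs)).sub ((hy s (hs₃.trans hs)).const_mul a))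
    (fun s hs => by
      have := hmono s hs
      have h1 : c * y s₃ ≤ c * y s := by gcongr
      have h2 : y s₃ * (c * y s₃ - b) ≤ y s * (c * y s - b) :=
        mul_le_mul this (by linarith) (by linarith) (by linarith)
      nlinarith) (-(a * K))
  obtain ⟨s₅, hs₅, h⟩ := exists_forall_le_of_deriv_le (f := v) (s₀ := s₄) one_pos
    (fun s hs => hv s (by linarith)) (fun s hs => by
      have h1 := hq s hs
      have h2 := hpos s (by linarith)
      have hKy : K ≤ y s := by nlinarith
      have hK1 : 1 ≤ K := by
        have : 0 ≤ (a ^ 2 + b + 1) / c := by positivity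
        linarith
      have hcK : c * K = a ^ 2 + b + 1 + c := by rw [hK]; field_simp
      have h3 : c * K ≤ c * y s := by gcongr
      have h4 : 0 < a * K := by nlinarith
      have h5 : a * (v s - a * y s) ≤ 0 := by nlinarith
      nlinarith) 0
  linarith [h s₅ le_rfl, hpos s₅ (by linarith)]

/-- A solution of positive energy cannot be nonincreasing for all large times. -/
lemma not_forall_nonpos_of_energy_pos (ha : 0 < a) (hb : 0 ≤ b) (hc : 0 < c) (hδ : 0 < δ)
    (hy : ∀ s ≥ s₁, HasDerivAt y (v s) s)
    (hv : ∀ s ≥ s₁, HasDerivAt v (a * v s + b * y s - c * y s ^ 2) s)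
    (hE : ∀ s ≥ s₁, δ ≤ v s ^ 2 / 2 + y s ^ 2 * (2 * c * y s - 3 * b) / 6)
    (hneg : ∀ s ≥ s₁, v s ≤ 0) : False := by
  have hanti : ∀ s ≥ s₁, ∀ t ≥ s, y t ≤ y s := fun s hs t ht => by
    have := le_affine_of_deriv_le (f := y) (m := 0) (s₀ := s)
      (fun r hr => hy r (hs.trans hr))
      (fun r hr => by simpa using hneg r (hs.trans hr)) t ht
    linarith
  -- Above the threshold `v' < 0`, so `v` stays below a negative constant and `y` cannot remain
  -- there.
  obtain ⟨s₄, hs₄, hy₄⟩ : ∃ s ≥ s₁, 2 * c * y s ≤ 3 * b := by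
    by_contra! hcon
    have hv' : ∀ s ≥ s₁, a * v s + b * y s - c * y s ^ 2 < 0 := fun s hs => by
      have h1 := hcon s hs
      have h2 : 0 < y s := by
        by_contra! h
        nlinarith
      nlinarith [mul_nonneg ha.le (neg_nonneg.2 (hneg s hs)), mul_pos h2 (show 0 < c * y s - b by linarith)]
    have hsa : StrictAntiOn v (Ici s₁) := strictAntiOn_of_deriv_neg (convex_Ici s₁)
      (fun x hx => (hv x hx).continuousAt.continuousWithinAt)
      (fun x hx => by
        rw [(hv x (interior_subset hx)).deriv]; exact hv' x (interior_subset hx))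
    have hlt : v (s₁ + 1) < 0 :=
      (hsa self_mem_Ici (show s₁ ≤ s₁ + 1 by linarith) (by linarith)).trans_le (hneg s₁ le_rfl)
    obtain ⟨s, hs, h⟩ := exists_forall_le_of_deriv_le (f := y) (s₀ := s₁ + 1)
      (neg_pos.2 hlt) (fun s hs => hy s (by linarith)) (fun s hs => by
        rw [neg_neg]
        exact hsa.antitoneOn (show s₁ ≤ s₁ + 1 by linarith) (show s₁ ≤ s by linarith) hs) 0
    have h1 := h s le_rfl
    have h2 := hcon s (by linarith)
    nlinarith
  have hvl : ∀ s ≥ s₄, v s ≤ -√δ := fun s hs => by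
    have h0 := hanti s₄ hs₄ s hs
    have h1 : 2 * c * y s ≤ 3 * b := by nlinarith
    have : √δ ≤ -v s := by
      refine Real.sqrt_le_iff.2 ⟨by linarith [hneg s (by linarith)], ?_⟩
      nlinarith [hE s (by linarith), mul_nonneg (sq_nonneg (y s)) (sub_nonneg.2 h1)]
    linarith
  obtain ⟨s₅, hs₅, h⟩ := exists_forall_le_of_deriv_le (Real.sqrt_pos.2 hδ)
    (fun s hs => hy s (by linarith)) hvl (-1)
  -- For `y < 0` the energy bound gives `v² ≥ (2c/3)(-y)³`, whence `k`.
  refine not_global_of_cube_le_sq (y := y) (v := v) (s₀ := s₅) (k := √(2 * c / 3))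
    (Real.sqrt_pos.2 (by positivity)) (fun s hs => hy s (by linarith))
    (fun s hs => by linarith [h s hs]) (fun s hs => hneg s (by linarith)) (fun s hs => ?_)
  rw [Real.sq_sqrt (by positivity)]
  nlinarith [hE s (by linarith), mul_nonneg hb (sq_nonneg (y s))]

/-- A solution of `y'' = a y' + b y - c y²` whose energy is bounded below by a positive constant
does not exist on a whole half-line. -/
lemma not_global_of_energy_pos (ha : 0 < a) (hb : 0 ≤ b) (hc : 0 < c) (hδ : 0 < δ)
    (hy : ∀ s ≥ s₁, HasDerivAt y (v s) s)
    (hv : ∀ s ≥ s₁, HasDerivAt v (a * v s + b * y s - c * y s ^ 2) s)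
    (hE : ∀ s ≥ s₁, δ ≤ v s ^ 2 / 2 + y s ^ 2 * (2 * c * y s - 3 * b) / 6) : False := by
  by_cases hpos : ∀ s ≥ s₁, 0 < v s
  · exact not_forall_pos_of_energy_pos ha hb hc hδ hy hv hE hpos
  push Not at hpos
  obtain ⟨s₂, hs₂, hv₂⟩ := hpos
  refine not_forall_nonpos_of_energy_pos (s₁ := s₂) ha hb hc hδ (fun s hs => hy s (by linarith))
    (fun s hs => hv s (by linarith)) (fun s hs => hE s (by linarith)) (fun s hs => ?_)
  -- Zero is a barrier for `v`: where `v = 0`, positive energy forces `2cy > 3b`, hence `v' = y (b -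
  -- c y) < 0`.
  refine image_le_of_deriv_right_lt_deriv_boundary (B := fun _ => 0) (B' := fun _ => 0) (a := s₂)
    (b := s) (fun x hx => (hv x (by linarith [hx.1])).continuousAt.continuousWithinAt)
    (fun x hx => (hv x (by linarith [hx.1])).hasDerivWithinAt) hv₂
    (fun x => hasDerivAt_const x 0) (fun x hx hx0 => ?_) ⟨hs, le_rfl⟩
  have h1 := hE x (by linarith [hx.1])
  have h2 : 0 < y x ^ 2 * (2 * c * y x - 3 * b) := by
    rw [hx0] at h1; linarith
  have h3 : 0 < 2 * c * y x - 3 * b := pos_of_mul_pos_right h2 (sq_nonneg _)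
  have h4 : 0 < y x := by
    by_contra! h
    nlinarith
  rw [hx0]
  nlinarith [mul_pos h4 (show 0 < c * y x - b by linarith)]

end

/-! ### Continuation past a finite endpoint -/

/-- Gluing at `α` of a differentiable function on a neighbourhood of `α` and one on `(α, ∞)`
with matching limits of the values and of the derivatives. -/
lemma hasDerivAt_ite_le {f f' g g' : ℝ → ℝ} {α ε : ℝ}
    (hg : ∀ t ∈ Ioo (α - ε) (α + ε), HasDerivAt g (g' t) t)
    (hf : ∀ t > α, HasDerivAt f (f' t) t)
    (hlim : Tendsto f (𝓝[>] α) (𝓝 (g α))) (hlim' : Tendsto f' (𝓝[>] α) (𝓝 (g' α))) :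
    ∀ t > α - ε, HasDerivAt (fun t => if t ≤ α then g t else f t)
      (if t ≤ α then g' t else f' t) t := by
  intro t ht
  rcases lt_trichotomy t α with h | rfl | h
  · rw [if_pos h.le]
    refine (hg t ⟨ht, by linarith⟩).congr_of_eventuallyEq ?_
    filter_upwards [Iio_mem_nhds h] with s hs
    rw [if_pos (le_of_lt hs)]
  · rw [if_pos le_rfl]
    have hl : HasDerivWithinAt (fun s => if s ≤ t then g s else f s) (g' t) (Iic t) t :=
      (hg t ⟨ht, by linarith⟩).hasDerivWithinAt.congr (fun s hs => if_pos hs) (if_pos le_rfl)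
    have hev : ∀ s > t, HasDerivAt (fun s => if s ≤ t then g s else f s) (f' s) s := fun s hs => by
      refine (hf s hs).congr_of_eventuallyEq ?_
      filter_upwards [Ioi_mem_nhds hs] with r hr
      rw [if_neg (not_le.2 hr)]
    have hr : HasDerivWithinAt (fun s => if s ≤ t then g s else f s) (g' t) (Ici t) t := by
      refine hasDerivWithinAt_Ici_of_tendsto_deriv (s := Ioi t)
        (fun s hs => (hev s hs).differentiableAt.differentiableWithinAt) ?_
        self_mem_nhdsWithin ?_
      · simp only [ContinuousWithinAt, le_refl, if_true]
        refine hlim.congr' ?_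
        filter_upwards [self_mem_nhdsWithin] with r hr
        rw [if_neg (not_le.2 hr)]
      · refine hlim'.congr' ?_
        filter_upwards [self_mem_nhdsWithin] with r hr
        exact (hev r hr).deriv.symm
    simpa [Iic_union_Ici] using hl.union hr
  · rw [if_neg (not_le.2 h)]
    refine (hf t h).congr_of_eventuallyEq ?_
    filter_upwards [Ioi_mem_nhds h] with s hs
    rw [if_neg (not_le.2 hs)]

/-- A function on a bounded interval `(α, t₀]` with bounded derivative has a limit at `α`
and is bounded. -/
lemma exists_tendsto_and_bound {f f' : ℝ → ℝ} {α t₀ C : ℝ} (h : α < t₀)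
    (hf : ∀ t ∈ Ioc α t₀, HasDerivAt f (f' t) t) (hC : ∀ t ∈ Ioc α t₀, |f' t| ≤ C) :
    (∃ l, Tendsto f (𝓝[>] α) (𝓝 l)) ∧ ∃ B, ∀ t ∈ Ioc α t₀, |f t| ≤ B := by
  have hC0 : 0 ≤ C := (abs_nonneg _).trans (hC t₀ ⟨h, le_rfl⟩)
  have hlip : LipschitzOnWith ⟨C, hC0⟩ f (Ioc α t₀) :=
    (convex_Ioc α t₀).lipschitzOnWith_of_nnnorm_hasDerivWithin_le
      (fun t ht => (hf t ht).hasDerivWithinAt) (fun t ht => hC t ht)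
  obtain ⟨g, hg, hfg⟩ := hlip.extend_real
  refine ⟨⟨g α, ?_⟩, ?_⟩
  · refine (hg.continuous.continuousAt.tendsto.mono_left nhdsWithin_le_nhds).congr' ?_
    filter_upwards [Ioc_mem_nhdsGT h] with t ht using (hfg ht).symm
  · obtain ⟨B, hB⟩ := isCompact_Icc.exists_bound_of_continuousOn (s := Icc α t₀)
      hg.continuous.continuousOn
    exact ⟨B, fun t ht => by rw [hfg ht]; exact hB t (Ioc_subset_Icc_self ht)⟩

/-! ### The equation for z: extension and energy -/

section

variable {N : ℕ} {z v : ℝ → ℝ} {I : Set ℝ}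

/-- The first-order system for `(z, z')` satisfied by a solution. -/
lemma SolvesOn.hasDerivAt (h : SolvesOn N z I) {t : ℝ} (ht : t ∈ I) :
    HasDerivAt z (deriv z t) t ∧ HasDerivAt (deriv z)
      (((N : ℝ) - 4) * deriv z t + (2 * (N : ℝ) - 4) * z t - ((N : ℝ) - 1) / 2 * z t ^ 2) t := by
  obtain ⟨h1, h2, h3⟩ := h t ht
  refine ⟨h1.hasDerivAt, ?_⟩
  exact h2.hasDerivAt.congr_deriv (by linarith)

/-- A solution of the first-order system is a solution of the second-order equation. -/
lemma solvesOn_of_hasDerivAt (hI : IsOpen I) (hz : ∀ t ∈ I, HasDerivAt z (v t) t)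
    (hv : ∀ t ∈ I, HasDerivAt v
      (((N : ℝ) - 4) * v t + (2 * (N : ℝ) - 4) * z t - ((N : ℝ) - 1) / 2 * z t ^ 2) t) :
    SolvesOn N z I := by
  intro t ht
  have he : deriv z =ᶠ[𝓝 t] v := by
    filter_upwards [hI.mem_nhds ht] with s hs using (hz s hs).deriv
  have hd := (hv t ht).congr_of_eventuallyEq he
  refine ⟨(hz t ht).differentiableAt, hd.differentiableAt, ?_⟩
  rw [hd.deriv, (hz t ht).deriv]
  ring

/-- Local existence for the first-order system. -/
lemma exists_local_solution (N : ℕ) (α z₀ v₀ : ℝ) :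
    ∃ (ε : ℝ) (x u : ℝ → ℝ), 0 < ε ∧ x α = z₀ ∧ u α = v₀ ∧
      (∀ t ∈ Ioo (α - ε) (α + ε), HasDerivAt x (u t) t) ∧
      ∀ t ∈ Ioo (α - ε) (α + ε), HasDerivAt u
        (((N : ℝ) - 4) * u t + (2 * (N : ℝ) - 4) * x t - ((N : ℝ) - 1) / 2 * x t ^ 2) t := by
  have hF : ContDiff ℝ 1 (fun p : ℝ × ℝ => (p.2,
      ((N : ℝ) - 4) * p.2 + (2 * (N : ℝ) - 4) * p.1 - ((N : ℝ) - 1) / 2 * p.1 ^ 2)) := by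
    fun_prop
  obtain ⟨φ, hφ, ε, hε, hd⟩ :=
    (hF.contDiffAt (x := (z₀, v₀))).exists_forall_mem_closedBall_exists_eq_forall_mem_Ioo_hasDerivAt₀
      α
  refine ⟨ε, fun t => (φ t).1, fun t => (φ t).2, hε, by simp [hφ], by simp [hφ],
    fun t ht => ?_, fun t ht => ?_⟩
  · exact hasFDerivAt_fst.comp_hasDerivAt t (hd t ht)
  · exact hasFDerivAt_snd.comp_hasDerivAt t (hd t ht)

/-- A solution on `(α, ∞)` that is bounded near `α` extends beyond `α`. -/
lemma SolvesOn.exists_extension {α t₀ : ℝ} (h : SolvesOn N z (Ioi α)) (ht₀ : α < t₀)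
    (hb : Bornology.IsBounded (z '' Ioc α t₀)) :
    ∃ (ε : ℝ) (y : ℝ → ℝ), 0 < ε ∧ SolvesOn N y (Ioi (α - ε)) ∧ EqOn y z (Ioi α) := by
  obtain ⟨M, hM⟩ := hb.exists_norm_le
  replace hM : ∀ t ∈ Ioc α t₀, |z t| ≤ M := fun t ht => hM _ (mem_image_of_mem z ht)
  have hM0 : 0 ≤ M := (abs_nonneg _).trans (hM t₀ ⟨ht₀, le_rfl⟩)
  -- Subtracting `(N-4) z` removes `z'` from the derivative, so a bound on `z` alone controls it;
  -- bounds and limits for `z'` follow.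
  obtain ⟨⟨l₁, hl₁⟩, B, hB⟩ := exists_tendsto_and_bound
    (f := fun t => deriv z t - ((N : ℝ) - 4) * z t)
    (f' := fun t => (2 * (N : ℝ) - 4) * z t - ((N : ℝ) - 1) / 2 * z t ^ 2)
    (C := |2 * (N : ℝ) - 4| * M + |((N : ℝ) - 1) / 2| * M ^ 2) ht₀
    (fun t ht => by
      obtain ⟨h1, h2⟩ := h.hasDerivAt (show t ∈ Ioi α from ht.1)
      exact (h2.sub (h1.const_mul ((N : ℝ) - 4))).congr_deriv (by ring))
    (fun t ht => by
      refine (abs_sub _ _).trans ?_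
      rw [abs_mul, abs_mul, abs_pow]
      have := hM t ht
      gcongr)
  obtain ⟨⟨l₀, hl₀⟩, -⟩ := exists_tendsto_and_bound (f := z) (f' := deriv z)
    (C := B + |(N : ℝ) - 4| * M) ht₀
    (fun t ht => (h.hasDerivAt (show t ∈ Ioi α from ht.1)).1)
    (fun t ht => by
      calc |deriv z t| = |(deriv z t - ((N : ℝ) - 4) * z t) + ((N : ℝ) - 4) * z t| := by ring_nf
        _ ≤ |deriv z t - ((N : ℝ) - 4) * z t| + |((N : ℝ) - 4) * z t| := abs_add_le _ _
        _ ≤ B + |(N : ℝ) - 4| * M := by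
          rw [abs_mul]
          have := hM t ht
          have := hB t ht
          gcongr)
  have hl₂ : Tendsto (deriv z) (𝓝[>] α) (𝓝 (l₁ + ((N : ℝ) - 4) * l₀)) := by
    simpa using hl₁.add (hl₀.const_mul ((N : ℝ) - 4))
  obtain ⟨ε, x, u, hε, rfl, hu, hx', hu'⟩ :=
    exists_local_solution N α l₀ (l₁ + ((N : ℝ) - 4) * l₀)
  rw [← hu] at hl₂
  have hz := hasDerivAt_ite_le hx' (fun t ht => (h.hasDerivAt (mem_Ioi.2 ht)).1) hl₀ hl₂
  have hv := hasDerivAt_ite_le hu' (fun t ht => (h.hasDerivAt (mem_Ioi.2 ht)).2) hl₂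
    (((hl₂.const_mul _).add (hl₀.const_mul _)).sub ((hl₀.pow 2).const_mul _))
  refine ⟨ε, _, hε, solvesOn_of_hasDerivAt isOpen_Ioi hz fun t ht => ?_, fun t ht =>
    if_neg (not_le.2 ht)⟩
  exact (hv t ht).congr_deriv (by split_ifs <;> rfl)

/-- The energy of a nontrivial solution tending to zero at `+∞` is bounded below backward in time
by a positive constant. -/
lemma SolvesOn.exists_energy_lower_bound (hN : N = 2 ∨ N = 3) (hI : IsOpen I)
    (hI' : I.OrdConnected) (hIu : ¬ BddAbove I) (h : SolvesOn N z I) (hz : Tendsto z atTop (𝓝 0))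
    (hne : ∃ t ∈ I, z t ≠ 0) :
    ∃ t₁ ∈ I, ∃ δ > 0, ∀ t ∈ I, t ≤ t₁ → δ ≤ deriv z t ^ 2 / 2 +
      z t ^ 2 * (2 * (((N : ℝ) - 1) / 2) * z t - 3 * (2 * (N : ℝ) - 4)) / 6 := by
  have hN4 : (N : ℝ) - 4 < 0 := by rcases hN with rfl | rfl <;> norm_num
  set E : ℝ → ℝ := fun t => deriv z t ^ 2 / 2 +
      z t ^ 2 * (2 * (((N : ℝ) - 1) / 2) * z t - 3 * (2 * (N : ℝ) - 4)) / 6 with hE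
  have hmem : ∀ t ∈ I, ∀ s ≥ t, s ∈ I := fun t ht s hs => by
    obtain ⟨r, hr, hsr⟩ := not_bddAbove_iff.1 hIu s
    exact hI'.out ht hr ⟨hs, hsr.le⟩
  have hd : ∀ t ∈ I, HasDerivAt E (((N : ℝ) - 4) * deriv z t ^ 2) t := fun t ht => by
    obtain ⟨h1, h2⟩ := h.hasDerivAt ht
    refine (((h2.pow 2).div_const 2).add (((h1.pow 2).mul ((h1.const_mul
      (2 * (((N : ℝ) - 1) / 2))).sub_const (3 * (2 * (N : ℝ) - 4)))).div_const 6)).congr_deriv ?_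
    simp only [Nat.cast_ofNat, Nat.add_one_sub_one, pow_one, Pi.pow_apply]
    ring
  have hanti : AntitoneOn E I := antitoneOn_of_deriv_nonpos hI'.convex
    (fun t ht => (hd t ht).continuousAt.continuousWithinAt)
    (fun t ht => (hd t (interior_subset ht)).differentiableAt.differentiableWithinAt)
    (fun t ht => by
      rw [(hd t (interior_subset ht)).deriv]
      exact mul_nonpos_of_nonpos_of_nonneg hN4.le (sq_nonneg _))
  have hnn : ∀ t ∈ I, 0 ≤ E t := fun t ht => by
    -- Only the potential part needs a limit: the kinetic part is nonnegative, so `z'` need not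
    -- converge.
    have hlim : Tendsto (fun t => z t ^ 2 * (2 * (((N : ℝ) - 1) / 2) * z t -
        3 * (2 * (N : ℝ) - 4)) / 6) atTop (𝓝 0) := by
      simpa using ((hz.pow 2).mul ((hz.const_mul (2 * (((N : ℝ) - 1) / 2))).sub_const
        (3 * (2 * (N : ℝ) - 4)))).div_const 6
    refine le_of_tendsto hlim ?_
    filter_upwards [eventually_ge_atTop t] with s hs
    refine le_trans ?_ (hanti ht (hmem t ht s hs) hs)
    have := sq_nonneg (deriv z s)
    simp only [hE]
    linarith
  by_cases hpos : ∃ t ∈ I, 0 < E t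
  · obtain ⟨t₁, ht₁, h1⟩ := hpos
    exact ⟨t₁, ht₁, E t₁, h1, fun t ht htt => hanti ht ht₁ htt⟩
  exfalso
  push Not at hpos
  have hE0 : ∀ t ∈ I, E t = 0 := fun t ht => le_antisymm (hpos t ht) (hnn t ht)
  have hz' : ∀ t ∈ I, deriv z t = 0 := fun t ht => by
    have h0 : E =ᶠ[𝓝 t] fun _ => 0 := by
      filter_upwards [hI.mem_nhds ht] with s hs using hE0 s hs
    have h1 := (hd t ht).unique ((hasDerivAt_const t (0 : ℝ)).congr_of_eventuallyEq h0)
    simpa [hN4.ne] using h1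
  obtain ⟨t, ht, hzt⟩ := hne
  have hconst : ∀ s ≥ t, z s = z t := fun s hs =>
    hI.is_const_of_deriv_eq_zero hI'.isPreconnected
      (fun r hr => (h.hasDerivAt hr).1.differentiableAt.differentiableWithinAt)
      hz' (hmem t ht s hs) ht
  refine hzt (tendsto_nhds_unique (tendsto_const_nhds.congr' ?_) hz)
  filter_upwards [eventually_ge_atTop t] with s hs using (hconst s hs).symm

/-- A solution on the whole line that tends to zero at `+∞` vanishes identically. -/
lemma SolvesOn.eq_zero (hN : N = 2 ∨ N = 3) (h : SolvesOn N z univ)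
    (hz : Tendsto z atTop (𝓝 0)) : z = 0 := by
  by_contra hne
  obtain ⟨t₁, -, δ, hδ, hE⟩ := h.exists_energy_lower_bound hN isOpen_univ ordConnected_univ
    not_bddAbove_univ hz (by
      obtain ⟨t, ht⟩ := Function.ne_iff.1 hne
      exact ⟨t, mem_univ t, ht⟩)
  refine not_global_of_energy_pos (a := 4 - N) (b := 2 * N - 4) (c := ((N : ℝ) - 1) / 2)
    (δ := δ) (s₁ := -t₁) (y := fun s => z (-s)) (v := fun s => -deriv z (-s))
    (by rcases hN with rfl | rfl <;> norm_num) (by rcases hN with rfl | rfl <;> norm_num)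
    (by rcases hN with rfl | rfl <;> norm_num) hδ (fun s _ => ?_) (fun s _ => ?_) (fun s hs => ?_)
  · have := (h.hasDerivAt (mem_univ (-s))).1
    exact (this.comp s (hasDerivAt_neg s)).congr_deriv (by ring)
  · have := ((h.hasDerivAt (mem_univ (-s))).2.comp s (hasDerivAt_neg s)).neg
    exact this.congr_deriv (by ring)
  · simpa using hE (-s) (mem_univ _) (by linarith)

end

/-! ### Return to w and conclusion -/

/-- The substitution `w = eᵗ z`. -/
lemma IsEntireSolution.solvesOn {N : ℕ} {w : ℝ → ℝ} (h : IsEntireSolution N w) :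
    SolvesOn N (fun t => Real.exp (-t) * w t) univ := by
  have he : ∀ t : ℝ, HasDerivAt (fun t : ℝ => Real.exp (-t)) (-Real.exp (-t)) t := fun t => by
    simpa using (hasDerivAt_neg t).exp
  refine solvesOn_of_hasDerivAt (v := fun t => Real.exp (-t) * (deriv w t - w t)) isOpen_univ
    (fun t _ => ?_) (fun t _ => ?_)
  · exact ((he t).mul (h.1 t).1.hasDerivAt).congr_deriv (by ring)
  · obtain ⟨h1, h2, h3⟩ := h.1 t
    refine ((he t).mul (h2.hasDerivAt.sub h1.hasDerivAt)).congr_deriv ?_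
    have : deriv (deriv w) t = ((N : ℝ) - 2) * deriv w t + ((N : ℝ) - 1) * w t -
        ((N : ℝ) - 1) / 2 * Real.exp (-t) * w t ^ 2 := by linarith
    rw [this, Pi.sub_apply]
    ring

end RadialHessian

theorem theorem3p7 (N : ℕ) (hN : N = 2 ∨ N = 3) :
    -- the entire problem has exactly the trivial solution
    (∀ w : ℝ → ℝ, RadialHessian.IsEntireSolution N w ↔ w = 0) ∧
    -- the same for the autonomous formulation
    (∀ z : ℝ → ℝ,
      (RadialHessian.SolvesOn N z Set.univ ∧ RadialHessian.EntireBC z) ↔ z = 0) ∧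
    -- nontrivial orbits on the stable manifold of the origin are unbounded backward in time
    (∀ (z : ℝ → ℝ) (I : Set ℝ), RadialHessian.IsMaximalSolution N z I → ¬ BddAbove I →
      RadialHessian.OnStableManifold z → (∃ t ∈ I, z t ≠ 0) →
      ∀ t₀ ∈ I, ¬ Bornology.IsBounded (z '' (I ∩ Set.Iic t₀))) ∧
    -- a nontrivial solution tending to zero at plus infinity is not defined on the whole line
    (∀ (z : ℝ → ℝ) (I : Set ℝ), IsOpen I → I.OrdConnected → ¬ BddAbove I →
      RadialHessian.SolvesOn N z I → Filter.Tendsto z Filter.atTop (nhds 0) →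
      (∃ t ∈ I, z t ≠ 0) → I ≠ Set.univ) := by
  have hexp : Tendsto (fun t : ℝ => Real.exp (-t)) atTop (𝓝 0) := Real.tendsto_exp_neg_atTop_nhds_zero
  have hglobal : ∀ (z : ℝ → ℝ) (I : Set ℝ), RadialHessian.SolvesOn N z I →
      Tendsto z atTop (𝓝 0) → (∃ t ∈ I, z t ≠ 0) → I ≠ univ := by
    rintro z I h hz ⟨t, -, ht⟩ rfl
    exact ht (congrFun (h.eq_zero hN hz) t)
  refine ⟨fun w => ⟨fun h => ?_, ?_⟩, fun z => ⟨fun h => ?_, ?_⟩, ?_,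
    fun z I _ _ _ => hglobal z I⟩
  · have h0 := h.solvesOn.eq_zero hN (by simpa using hexp.mul h.2.2)
    funext t
    simpa using congrFun h0 t
  · rintro rfl
    exact ⟨fun t => by simp [Pi.zero_def], tendsto_const_nhds, tendsto_const_nhds⟩
  · refine h.1.eq_zero hN ?_
    have := hexp.mul h.2.2
    simpa [← mul_assoc, ← Real.exp_add] using this
  · rintro rfl
    exact ⟨fun t _ => by simp [Pi.zero_def], by simp [RadialHessian.EntireBC]⟩
  · rintro z I ⟨hI, hI', h, hmax⟩ hIu hs hne t₀ ht₀ hb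
    have hz : Tendsto z atTop (𝓝 0) := (continuous_fst.tendsto ((0 : ℝ), (0 : ℝ))).comp hs
    have hIne := hglobal z I h hz hne
    have hmem : ∀ t ∈ I, ∀ s ≥ t, s ∈ I := fun t ht s hs => by
      obtain ⟨r, hr, hsr⟩ := not_bddAbove_iff.1 hIu s
      exact hI'.out ht hr ⟨hs, hsr.le⟩
    have hbelow : BddBelow I := by
      by_contra hbb
      refine hIne (eq_univ_of_forall fun s => ?_)
      obtain ⟨r, hr, hrs⟩ := not_bddBelow_iff.1 hbb s
      exact hmem r hr s hrs.le
    -- An up-closed open set that is bounded below is an open ray; openness excludes the infimum.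
    obtain ⟨α, rfl⟩ : ∃ α, I = Ioi α := by
      refine ⟨sInf I, Subset.antisymm (fun t ht => ?_) (fun t ht => ?_)⟩
      · obtain ⟨r, hrt, hr⟩ := mem_nhdsLT_iff_exists_Ioo_subset.1
          (mem_nhdsWithin_of_mem_nhds (t := Iio t) (hI.mem_nhds ht))
        obtain ⟨q, hq⟩ := exists_between (mem_Iio.1 hrt)
        exact (csInf_le hbelow (hr hq)).trans_lt hq.2
      · obtain ⟨r, hr, hrt⟩ := exists_lt_of_csInf_lt ⟨t₀, ht₀⟩ (mem_Ioi.1 ht)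
        exact hmem r hr t hrt.le
    rw [Ioi_inter_Iic] at hb
    obtain ⟨ε, y, hε, hy, hyz⟩ := h.exists_extension ht₀ hb
    have hJ := hmax _ y isOpen_Ioi ordConnected_Ioi (Ioi_subset_Ioi (by linarith)) hy hyz
    have := Ioi_inj.1 hJ
    linarith
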